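/- Let $a\in\mathbb R$ and $\beta,\eta,\nu>0$, and let $h:\mathbb R\to[0,\infty)$ be measurable and bounded, non-decreasing on $[a,c)$ and non-increasing on $(c,\infty)$ for some $a\le c\le\infty$. Consider the convex-tail problem $$\max_f\ \int_a^\infty h(x)f(x)\,dx$$ over all convex functions $f:[a,\infty)\to[0,\infty)$ with $\int_a^\infty f(x)\,dx=\beta$, $f(a)=f(a+)=\eta$ and right derivative $f_+'(a)\ge-\nu$. Put $H(x)=\int_0^x\int_0^u h(v+a)\,dv\,du$, suppose that the limit $\lambda=\lim_{x\to\infty}H(x)/x^2$ exists and is finite, and suppose that the problem has a feasible solution. If $\lambda=0$, then an optimal solution exists. Moreover, it can be chosen light-tailed: there is an optimal solution that is continuous on $[a,\infty)$ and piecewise linear with at most two line segments before vanishing, that is, there are $a=y_0\le y_1\le y_2<\infty$ such that it is affine on $[y_0,y_1]$ and on $[y_1,y_2]$ and zero on $(y_2,\infty)$. -/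

import Mathlib

open Set Filter Topology MeasureTheory

noncomputable section

namespace ConvexTail

/-- `f` is a feasible convex tail on `[a, ∞)`: total mass `β`, value `f(a) = f(a+) = η`,
right derivative `f'₊(a) ≥ -ν`, convex and non-negative on `[a, ∞)`.
The values of `f` to the left of `a` play no role. -/
structure IsFeasible (a β η ν : ℝ) (f : ℝ → ℝ) : Prop where
  integrableOn : IntegrableOn f (Ici a)
  integral_eq : ∫ x in Ici a, f x = β
  value_eq : f a = η
  right_limit : Tendsto f (𝓝[>] a) (𝓝 η)
  right_deriv : ∃ d : ℝ, HasDerivWithinAt f d (Ioi a) a ∧ -ν ≤ d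
  convexOn : ConvexOn ℝ (Ici a) f
  nonneg : ∀ x, a ≤ x → 0 ≤ f x

/-- The objective `∫_a^∞ h(x) f(x) dx`. -/
def objective (a : ℝ) (h f : ℝ → ℝ) : ℝ := ∫ x in Ici a, h x * f x

/-- `f` is an optimal solution of the convex-tail problem: it is feasible and maximizes the
objective among all feasible tails. -/
def IsOptimal (a β η ν : ℝ) (h f : ℝ → ℝ) : Prop :=
  IsFeasible a β η ν f ∧ ∀ g : ℝ → ℝ, IsFeasible a β η ν g → objective a h g ≤ objective a h f

/-- `h ≥ 0` is bounded, non-decreasing on `[a, c)` and non-increasing on `(c, ∞)` for some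
`a ≤ c ≤ ∞`. -/
structure IsUnimodal (a : ℝ) (h : ℝ → ℝ) : Prop where
  nonneg : ∀ x, 0 ≤ h x
  bounded : ∃ C : ℝ, ∀ x, h x ≤ C
  mode : ∃ c : EReal, (a : EReal) ≤ c ∧
    MonotoneOn h {x : ℝ | a ≤ x ∧ (x : EReal) < c} ∧
    AntitoneOn h {x : ℝ | c < (x : EReal)}

/-- `H(x) = ∫_0^x ∫_0^u h(v + a) dv du`. -/
def H (a : ℝ) (h : ℝ → ℝ) (x : ℝ) : ℝ := ∫ u in (0 : ℝ)..x, ∫ v in (0 : ℝ)..u, h (v + a)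

/-- The class of non-negative, continuous, piecewise linear functions on `[a, ∞)` with at most
`m` line segments before vanishing. -/
def PLPos (m : ℕ) (a : ℝ) : Set (ℝ → ℝ) :=
  {f | ContinuousOn f (Ici a) ∧ (∀ x, a ≤ x → 0 ≤ f x) ∧
    ∃ (y : Fin (m + 1) → ℝ) (c d : Fin m → ℝ), y 0 = a ∧ Monotone y ∧
      (∀ (j : Fin m), ∀ x ∈ Icc (y j.castSucc) (y j.succ), f x = c j + d j * x) ∧
      ∀ x, y (Fin.last m) < x → f x = 0}

end ConvexTail

end

/-! Cut and exchange. Let `f` be feasible and `[p, q]` an interval on which `h` is at least as large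
as outside it. Replace `f` by the positive part of the maximum of its tangent at `a` and its chord
over `[p, q]`. The cut lies above `f` on `[p, q]` and below it elsewhere, so if it has no less mass
it has no smaller objective (`Separates.objective_le`). It is a sum of two tents
(`exists_cut_eq_twoTent`). A short interval adds little mass and a long one brings the mass up to
`β`; since the level intervals vary continuously with their length, an intermediate value argument
gives mass in `[β, β + ε]` (`exists_twoTent_of_path`, `IsFeasible.exists_twoTent`). The condition `λ
= 0` guarantees a finite mode.

Two tents have four parameters, so a maximizing sequence has a limit unless the longer tent runs off
to infinity. Then its mass stays bounded while its objective value tends to zero, because tent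
values grow subquadratically when `λ = 0`. The remaining tent has value `η` and mass at most `β`;
lengthening it to mass `β` does not lower the objective, since the tent value is convex in the
length and vanishes at zero (`exists_isTwoTent_of_tendsto`). -/

namespace ConvexTail

/-! ### Tents and their objective values -/

/-- The triangular tail `x ↦ (s - (x - a))₊`. -/
def tent (a s x : ℝ) : ℝ := max (s - (x - a)) 0

/-- The objective value of `tent a s`. -/
noncomputable def tentValue (a : ℝ) (h : ℝ → ℝ) (s : ℝ) : ℝ := ∫ x in Ici a, h x * tent a s x

lemma tent_nonneg (a s x : ℝ) : 0 ≤ tent a s x := le_max_right _ _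

lemma continuous_tent (a s : ℝ) : Continuous (tent a s) := by
  unfold tent; fun_prop

lemma tent_eq_zero {a s x : ℝ} (hx : a + s ≤ x) : tent a s x = 0 :=
  max_eq_right (by linarith)

lemma tent_eq_sub {a s x : ℝ} (hx : x ≤ a + s) : tent a s x = s - (x - a) :=
  max_eq_left (by linarith)

lemma integrableOn_tent (a s : ℝ) : IntegrableOn (tent a s) (Ici a) := by
  have h1 : IntegrableOn (tent a s) (Icc a (a + s)) :=
    (continuous_tent a s).continuousOn.integrableOn_Icc
  refine h1.of_forall_sdiff_eq_zero measurableSet_Ici ?_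
  rintro x ⟨hx, hx'⟩
  refine tent_eq_zero ?_
  by_contra hlt
  exact hx' ⟨hx, by linarith⟩

lemma integral_tent (a : ℝ) {s : ℝ} (hs : 0 ≤ s) : ∫ x in Ici a, tent a s x = s ^ 2 / 2 := by
  have h1 : ∫ x in Ici a, tent a s x = ∫ x in Ioc a (a + s), (a + s - x) := by
    rw [integral_Ici_eq_integral_Ioi]
    rw [setIntegral_eq_of_subset_of_forall_sdiff_eq_zero measurableSet_Ioi
      (show Ioc a (a + s) ⊆ Ioi a from fun _ hx => hx.1)]
    · refine setIntegral_congr_fun measurableSet_Ioc fun x hx => ?_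
      rw [tent_eq_sub hx.2]; ring
    · rintro x ⟨hx, hx'⟩
      refine tent_eq_zero ?_
      by_contra hlt
      exact hx' ⟨hx, by linarith⟩
  rw [h1, ← intervalIntegral.integral_of_le (by linarith)]
  rw [intervalIntegral.integral_sub (by simp) (by simp)]
  simp
  ring

lemma integrableOn_mul_of_bounded {a C : ℝ} {h f : ℝ → ℝ} (hmeas : Measurable h)
    (hnn : ∀ x, 0 ≤ h x) (hC : ∀ x, h x ≤ C) (hf : IntegrableOn f (Ici a)) :
    IntegrableOn (fun x => h x * f x) (Ici a) := by
  refine Integrable.bdd_mul (c := C) hf hmeas.aestronglyMeasurable ?_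
  refine Eventually.of_forall fun x => ?_
  rw [Real.norm_eq_abs, abs_of_nonneg (hnn x)]
  exact hC x

section Value

variable {a C : ℝ} {h : ℝ → ℝ}

lemma tentValue_nonneg (hnn : ∀ x, 0 ≤ h x) (s : ℝ) : 0 ≤ tentValue a h s :=
  integral_nonneg fun x => mul_nonneg (hnn x) (tent_nonneg _ _ _)

lemma tentValue_zero : tentValue a h 0 = 0 := by
  unfold tentValue
  rw [setIntegral_congr_fun (g := fun _ => (0 : ℝ)) measurableSet_Ici]
  · simp
  · intro x hx
    have : a ≤ x := hx
    simp [tent_eq_zero (a := a) (s := 0) (x := x) (by linarith)]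

/-- For fixed `x` the tent is convex in its length, and integration against `h ≥ 0` preserves this.
-/
lemma convexOn_tentValue (hmeas : Measurable h) (hnn : ∀ x, 0 ≤ h x) (hC : ∀ x, h x ≤ C) :
    ConvexOn ℝ univ (tentValue a h) := by
  refine ⟨convex_univ, ?_⟩
  intro s _ t _ u v hu hv huv
  have hi := fun r => integrableOn_mul_of_bounded hmeas hnn hC (integrableOn_tent a r)
  simp only [tentValue, smul_eq_mul]
  rw [← integral_const_mul, ← integral_const_mul,
    ← integral_add ((hi s).const_mul u) ((hi t).const_mul v)]
  refine integral_mono (hi _) (((hi s).const_mul u).add ((hi t).const_mul v)) fun x => ?_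
  have h1 : tent a (u * s + v * t) x ≤ u * tent a s x + v * tent a t x := by
    unfold tent
    refine max_le ?_ (by positivity)
    have e1 := mul_le_mul_of_nonneg_left (le_max_left (s - (x - a)) 0) hu
    have e2 := mul_le_mul_of_nonneg_left (le_max_left (t - (x - a)) 0) hv
    have e3 : x - a = u * (x - a) + v * (x - a) := by rw [← add_mul, huv, one_mul]
    linarith
  have h2 := mul_le_mul_of_nonneg_left h1 (hnn x)
  simp only
  linarith

/-- The tent is at most `s` and lives on `[a, a + s]`, which gives `s * F s`; as `F` is
non-decreasing, its integral over `[s, 2s]` is at least that. A crude bound suffices for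
subquadratic growth. -/
lemma tentValue_le_H (hmeas : Measurable h) (hnn : ∀ x, 0 ≤ h x) (hC : ∀ x, h x ≤ C)
    {s : ℝ} (hs : 0 ≤ s) : tentValue a h s ≤ H a h (2 * s) := by
  have hii : ∀ u v, IntervalIntegrable (fun v => h (v + a)) volume u v := by
    intro u v
    refine (intervalIntegrable_const (c := C)).mono_fun
      (hmeas.comp (measurable_id.add_const a)).aestronglyMeasurable ?_
    refine Eventually.of_forall fun x => ?_
    simp only [Real.norm_eq_abs]
    rw [abs_of_nonneg (hnn _)]
    exact (hC _).trans (le_abs_self C)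
  set F : ℝ → ℝ := fun u => ∫ v in (0 : ℝ)..u, h (v + a) with hF
  have hFc : Continuous F := intervalIntegral.continuous_primitive hii 0
  have hF0 : ∀ u, 0 ≤ u → 0 ≤ F u := fun u hu =>
    intervalIntegral.integral_nonneg hu fun x _ => hnn _
  have hFm : ∀ u, s ≤ u → F s ≤ F u := by
    intro u hu
    have := intervalIntegral.integral_add_adjacent_intervals (hii 0 s) (hii s u)
    have h2 : 0 ≤ ∫ v in s..u, h (v + a) := intervalIntegral.integral_nonneg hu fun x _ => hnn _
    simp only [hF]
    linarith
  have h1 : tentValue a h s ≤ s * F s := by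
    have e1 : F s = ∫ x in Ioc a (a + s), h x := by
      simp only [hF]
      rw [intervalIntegral.integral_comp_add_right (fun x => h x),
        intervalIntegral.integral_of_le (by linarith)]
      simp [add_comm]
    rw [e1, ← integral_const_mul]
    have hio : IntegrableOn h (Ioc a (a + s)) := by
      have := (hii 0 s).comp_sub_right a
      simp only [sub_add_cancel] at this
      rw [intervalIntegrable_iff_integrableOn_Ioc_of_le (by linarith)] at this
      simpa [add_comm] using this
    unfold tentValue
    rw [integral_Ici_eq_integral_Ioi]
    rw [setIntegral_eq_of_subset_of_forall_sdiff_eq_zero measurableSet_Ioi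
      (show Ioc a (a + s) ⊆ Ioi a from fun _ hx => hx.1)]
    · refine setIntegral_mono_on ?_ (hio.const_mul s) measurableSet_Ioc fun x hx => ?_
      · exact (integrableOn_mul_of_bounded hmeas hnn hC (integrableOn_tent a s)).mono_set
          (fun x hx => le_of_lt hx.1)
      · rw [tent_eq_sub hx.2, mul_comm]
        exact mul_le_mul_of_nonneg_right (by linarith [hx.1]) (hnn x)
    · rintro x ⟨hx, hx'⟩
      rw [tent_eq_zero, mul_zero]
      by_contra hlt
      exact hx' ⟨hx, by linarith⟩
  have h2 : s * F s ≤ H a h (2 * s) := by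
    have e : H a h (2 * s) = ∫ u in (0 : ℝ)..(2 * s), F u := rfl
    rw [e, ← intervalIntegral.integral_add_adjacent_intervals
      (hFc.intervalIntegrable 0 s) (hFc.intervalIntegrable s (2 * s))]
    have e1 : 0 ≤ ∫ u in (0 : ℝ)..s, F u :=
      intervalIntegral.integral_nonneg hs fun u hu => hF0 u hu.1
    have e2 : ∫ u in s..(2 * s), F s ≤ ∫ u in s..(2 * s), F u :=
      intervalIntegral.integral_mono_on (by linarith) (by simp)
        (hFc.intervalIntegrable s (2 * s)) fun u hu => hFm u hu.1
    rw [intervalIntegral.integral_const, smul_eq_mul] at e2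
    have : (2 * s - s) * F s = s * F s := by ring
    linarith
  exact h1.trans h2

lemma tendsto_tentValue_div_sq (hmeas : Measurable h) (hnn : ∀ x, 0 ≤ h x) (hC : ∀ x, h x ≤ C)
    (hlim : Tendsto (fun x : ℝ => H a h x / x ^ 2) atTop (𝓝 0)) :
    Tendsto (fun s : ℝ => tentValue a h s / s ^ 2) atTop (𝓝 0) := by
  have h1 : Tendsto (fun s : ℝ => 4 * (H a h (2 * s) / (2 * s) ^ 2)) atTop (𝓝 0) := by
    have := (hlim.comp (tendsto_id.const_mul_atTop (by norm_num : (0 : ℝ) < 2))).const_mul 4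
    simpa using this
  refine squeeze_zero' ?_ ?_ h1
  · exact Eventually.of_forall fun s => div_nonneg (tentValue_nonneg hnn s) (sq_nonneg s)
  · filter_upwards [eventually_gt_atTop 0] with s hs
    have := tentValue_le_H (a := a) hmeas hnn hC hs.le
    have e : 4 * (H a h (2 * s) / (2 * s) ^ 2) = H a h (2 * s) / s ^ 2 := by
      field_simp; ring
    rw [e]
    gcongr

end Value

/-! ### Sums of two tents -/

/-- Two tents of heights `w₁ s₁` and `w₂ s₂`, whose sum has value `η`, mass `b` and initial slope
at least `-ν`. -/
structure IsTwoTent (η ν b w₁ s₁ w₂ s₂ : ℝ) : Prop where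
  w₁_nonneg : 0 ≤ w₁
  w₂_nonneg : 0 ≤ w₂
  s₁_nonneg : 0 ≤ s₁
  s₁_le : s₁ ≤ s₂
  slope : w₁ + w₂ ≤ ν
  value : w₁ * s₁ + w₂ * s₂ = η
  mass : w₁ * s₁ ^ 2 + w₂ * s₂ ^ 2 = 2 * b

/-- The sum of two tents. -/
def twoTent (a w₁ s₁ w₂ s₂ x : ℝ) : ℝ := w₁ * tent a s₁ x + w₂ * tent a s₂ x

lemma integrableOn_twoTent (a w₁ s₁ w₂ s₂ : ℝ) : IntegrableOn (twoTent a w₁ s₁ w₂ s₂) (Ici a) :=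
  ((integrableOn_tent a s₁).const_mul w₁).add ((integrableOn_tent a s₂).const_mul w₂)

lemma integral_twoTent (a w₁ w₂ : ℝ) {s₁ s₂ : ℝ} (h₁ : 0 ≤ s₁) (h₂ : 0 ≤ s₂) :
    ∫ x in Ici a, twoTent a w₁ s₁ w₂ s₂ x = (w₁ * s₁ ^ 2 + w₂ * s₂ ^ 2) / 2 := by
  unfold twoTent
  rw [integral_add ((integrableOn_tent a s₁).const_mul w₁) ((integrableOn_tent a s₂).const_mul w₂),
    integral_const_mul, integral_const_mul, integral_tent a h₁, integral_tent a h₂]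
  ring

lemma objective_twoTent {a C : ℝ} {h : ℝ → ℝ} (hmeas : Measurable h) (hnn : ∀ x, 0 ≤ h x)
    (hC : ∀ x, h x ≤ C) (w₁ s₁ w₂ s₂ : ℝ) :
    objective a h (twoTent a w₁ s₁ w₂ s₂) = w₁ * tentValue a h s₁ + w₂ * tentValue a h s₂ := by
  have hi := fun r => integrableOn_mul_of_bounded hmeas hnn hC (integrableOn_tent a r)
  unfold objective tentValue
  rw [← integral_const_mul, ← integral_const_mul,
    ← integral_add ((hi s₁).const_mul w₁) ((hi s₂).const_mul w₂)]
  congr 1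
  ext x
  unfold twoTent
  ring

lemma convexOn_tent (a s : ℝ) : ConvexOn ℝ univ (tent a s) := by
  have h1 : ConvexOn ℝ univ fun x : ℝ => s - (x - a) := by
    refine ⟨convex_univ, fun x _ y _ u v _ _ huv => le_of_eq ?_⟩
    simp only [smul_eq_mul]
    have : s + a = u * (s + a) + v * (s + a) := by rw [← add_mul, huv, one_mul]
    linarith
  exact h1.sup (convexOn_const 0 convex_univ)

/-- The slope is `-1` except for the degenerate tent `s = 0`, where it is `0`; hence only a bound.
-/
lemma hasDerivWithinAt_tent (a : ℝ) {s : ℝ} (hs : 0 ≤ s) :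
    ∃ d : ℝ, HasDerivWithinAt (tent a s) d (Ioi a) a ∧ -1 ≤ d := by
  rcases hs.eq_or_lt with rfl | hs
  · refine ⟨0, ?_, by norm_num⟩
    refine (hasDerivWithinAt_const a (Ioi a) (0 : ℝ)).congr (fun x hx => ?_) ?_
    · have : a < x := hx
      exact tent_eq_zero (by linarith)
    · exact tent_eq_zero (by linarith)
  · refine ⟨-1, ?_, le_rfl⟩
    have h1 : HasDerivAt (fun x : ℝ => s - (x - a)) (-1) a := by
      simpa using ((hasDerivAt_id a).sub_const a).const_sub s
    refine (h1.congr_of_eventuallyEq ?_).hasDerivWithinAt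
    filter_upwards [Iio_mem_nhds (show a < a + s by linarith)] with x hx
    exact tent_eq_sub (le_of_lt hx)

lemma IsTwoTent.isFeasible {η ν b w₁ s₁ w₂ s₂ : ℝ} (c : IsTwoTent η ν b w₁ s₁ w₂ s₂) (a : ℝ) :
    IsFeasible a b η ν (twoTent a w₁ s₁ w₂ s₂) := by
  have hs₂ := c.s₁_nonneg.trans c.s₁_le
  have hv : twoTent a w₁ s₁ w₂ s₂ a = η := by
    unfold twoTent
    rw [tent_eq_sub (by linarith [c.s₁_nonneg]), tent_eq_sub (by linarith), ← c.value]
    ring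
  have hcont : Continuous (twoTent a w₁ s₁ w₂ s₂) :=
    ((continuous_tent a s₁).const_mul w₁).add ((continuous_tent a s₂).const_mul w₂)
  refine ⟨integrableOn_twoTent _ _ _ _ _, ?_, hv, ?_, ?_, ?_, ?_⟩
  · rw [integral_twoTent a w₁ w₂ c.s₁_nonneg hs₂, c.mass]; ring
  · have := hcont.tendsto a
    rw [hv] at this
    exact this.mono_left nhdsWithin_le_nhds
  · obtain ⟨d₁, h₁, k₁⟩ := hasDerivWithinAt_tent a c.s₁_nonneg
    obtain ⟨d₂, h₂, k₂⟩ := hasDerivWithinAt_tent a hs₂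
    refine ⟨w₁ * d₁ + w₂ * d₂, (h₁.const_mul w₁).add (h₂.const_mul w₂), ?_⟩
    nlinarith [mul_le_mul_of_nonneg_left k₁ c.w₁_nonneg, mul_le_mul_of_nonneg_left k₂ c.w₂_nonneg,
      c.slope]
  · exact ((((convexOn_tent a s₁).smul c.w₁_nonneg).add
      ((convexOn_tent a s₂).smul c.w₂_nonneg)).subset (subset_univ _) (convex_Ici a))
  · intro x _
    exact add_nonneg (mul_nonneg c.w₁_nonneg (tent_nonneg _ _ _))
      (mul_nonneg c.w₂_nonneg (tent_nonneg _ _ _))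

lemma IsTwoTent.mem_PLPos {η ν b w₁ s₁ w₂ s₂ : ℝ} (c : IsTwoTent η ν b w₁ s₁ w₂ s₂) (a : ℝ) :
    twoTent a w₁ s₁ w₂ s₂ ∈ PLPos 2 a := by
  have hs₁ := c.s₁_nonneg
  have hs₁₂ := c.s₁_le
  have hcont : Continuous (twoTent a w₁ s₁ w₂ s₂) :=
    ((continuous_tent a s₁).const_mul w₁).add ((continuous_tent a s₂).const_mul w₂)
  refine ⟨hcont.continuousOn, (c.isFeasible a).nonneg, ![a, a + s₁, a + s₂],
    ![w₁ * (s₁ + a) + w₂ * (s₂ + a), w₂ * (s₂ + a)], ![-(w₁ + w₂), -w₂], rfl, ?_, ?_, ?_⟩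
  · rw [Fin.monotone_iff_le_succ]
    intro i
    fin_cases i <;> simp <;> linarith
  · intro j x hx
    fin_cases j
    · have h1 : x ≤ a + s₁ := by simpa using hx.2
      simp only [twoTent]
      rw [tent_eq_sub h1, tent_eq_sub (by linarith)]
      simp; ring
    · have h1 : a + s₁ ≤ x := by simpa using hx.1
      have h2 : x ≤ a + s₂ := by simpa using hx.2
      simp only [twoTent]
      rw [tent_eq_zero h1, tent_eq_sub h2]
      simp; ring
  · intro x hx
    have h1 : a + s₂ < x := by simpa [Fin.last] using hx
    simp only [twoTent]
    rw [tent_eq_zero (by linarith), tent_eq_zero h1.le]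
    simp

/-- Value `η` and mass `β` determine a single tent; the second one gets weight zero. -/
lemma isTwoTent_single {η ν β : ℝ} (hη : 0 < η) (hβ : 0 < β) (hν : η ^ 2 ≤ 2 * β * ν) :
    IsTwoTent η ν β (η ^ 2 / (2 * β)) (2 * β / η) 0 (2 * β / η) := by
  refine ⟨by positivity, le_rfl, by positivity, le_rfl, ?_, ?_, ?_⟩
  · rw [add_zero, div_le_iff₀ (by positivity)]; linarith
  · field_simp; ring
  · field_simp; ring

/-! ### Compactness and escaping mass -/

/-- A limit of two-tent configurations is dominated by a two-tent configuration: mass that escapes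
to infinity contributes nothing to the objective, and can be recovered by lengthening the tent that
stays. -/
lemma exists_isTwoTent_of_tendsto {η ν β V : ℝ} (hη : 0 < η) (hβ : 0 < β) {Φ : ℝ → ℝ}
    (hΦ : ConvexOn ℝ univ Φ) (hΦ0 : Φ 0 = 0) (hΦnn : ∀ s, 0 ≤ Φ s)
    (hΦlim : Tendsto (fun s => Φ s / s ^ 2) atTop (𝓝 0))
    {b v w₁ s₁ w₂ s₂ : ℕ → ℝ} (hb : Tendsto b atTop (𝓝 β)) (hv : Tendsto v atTop (𝓝 V))
    (hc : ∀ n, IsTwoTent η ν (b n) (w₁ n) (s₁ n) (w₂ n) (s₂ n))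
    (hval : ∀ n, v n ≤ w₁ n * Φ (s₁ n) + w₂ n * Φ (s₂ n)) :
    ∃ x₁ t₁ x₂ t₂ : ℝ, IsTwoTent η ν β x₁ t₁ x₂ t₂ ∧ V ≤ x₁ * Φ t₁ + x₂ * Φ t₂ := by
  have hΦc : Continuous Φ := by
    have := hΦ.continuousOn isOpen_univ
    rwa [← continuousOn_univ]
  obtain ⟨B, hB⟩ := hb.bddAbove_range
  have hB : ∀ n, b n ≤ B := fun n => hB ⟨n, rfl⟩
  -- Since `s₁ ≤ s₂`, `η * s₁ = w₁ s₁² + w₂ s₂ s₁` is at most twice the mass: the shorter tent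
  -- cannot escape.
  have hs₁ : ∀ n, s₁ n ∈ Icc 0 (2 * B / η) := by
    intro n
    have c := hc n
    refine ⟨c.s₁_nonneg, ?_⟩
    rw [le_div_iff₀ hη]
    have h1 : w₂ n * s₂ n * s₁ n ≤ w₂ n * s₂ n * s₂ n :=
      mul_le_mul_of_nonneg_left c.s₁_le (mul_nonneg c.w₂_nonneg (c.s₁_nonneg.trans c.s₁_le))
    have h2 := c.mass
    have h3 := hB n
    rw [← c.value]
    nlinarith
  have hw₁ : ∀ n, w₁ n ∈ Icc 0 ν := fun n =>
    ⟨(hc n).w₁_nonneg, by linarith [(hc n).slope, (hc n).w₂_nonneg]⟩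
  have hw₂ : ∀ n, w₂ n ∈ Icc 0 ν := fun n =>
    ⟨(hc n).w₂_nonneg, by linarith [(hc n).slope, (hc n).w₁_nonneg]⟩
  by_cases hR : ∃ R, ∃ᶠ n in atTop, s₂ n ≤ R
  · obtain ⟨R, hR⟩ := hR
    obtain ⟨φ, hφ, hφR⟩ := extraction_of_frequently_atTop hR
    have hK : IsCompact (Icc 0 ν ×ˢ (Icc 0 (2 * B / η) ×ˢ (Icc 0 ν ×ˢ Icc 0 R))) :=
      isCompact_Icc.prod (isCompact_Icc.prod (isCompact_Icc.prod isCompact_Icc))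
    obtain ⟨⟨x₁, t₁, x₂, t₂⟩, -, ψ, hψ, hlim⟩ := hK.tendsto_subseq
      (x := fun n => (w₁ (φ n), s₁ (φ n), w₂ (φ n), s₂ (φ n)))
      (fun n => ⟨hw₁ _, hs₁ _, hw₂ _, (hc _).s₁_nonneg.trans (hc _).s₁_le, hφR n⟩)
    have hsub : Tendsto (fun n => φ (ψ n)) atTop atTop := hφ.tendsto_atTop.comp hψ.tendsto_atTop
    have l₁ : Tendsto (fun n => w₁ (φ (ψ n))) atTop (𝓝 x₁) := hlim.fst_nhds
    have m₁ : Tendsto (fun n => s₁ (φ (ψ n))) atTop (𝓝 t₁) := hlim.snd_nhds.fst_nhds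
    have l₂ : Tendsto (fun n => w₂ (φ (ψ n))) atTop (𝓝 x₂) := hlim.snd_nhds.snd_nhds.fst_nhds
    have m₂ : Tendsto (fun n => s₂ (φ (ψ n))) atTop (𝓝 t₂) := hlim.snd_nhds.snd_nhds.snd_nhds
    have hc' := fun n => hc (φ (ψ n))
    refine ⟨x₁, t₁, x₂, t₂, ⟨?_, ?_, ?_, ?_, ?_, ?_, ?_⟩, ?_⟩
    · exact ge_of_tendsto' l₁ fun n => (hc' n).w₁_nonneg
    · exact ge_of_tendsto' l₂ fun n => (hc' n).w₂_nonneg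
    · exact ge_of_tendsto' m₁ fun n => (hc' n).s₁_nonneg
    · exact le_of_tendsto_of_tendsto' m₁ m₂ fun n => (hc' n).s₁_le
    · exact le_of_tendsto' (l₁.add l₂) fun n => (hc' n).slope
    · refine tendsto_nhds_unique ((l₁.mul m₁).add (l₂.mul m₂)) ?_
      exact tendsto_const_nhds.congr fun n => (hc' n).value.symm
    · refine tendsto_nhds_unique ((l₁.mul (m₁.pow 2)).add (l₂.mul (m₂.pow 2))) ?_
      exact ((hb.comp hsub).const_mul 2).congr fun n => (hc' n).mass.symm
    · exact le_of_tendsto_of_tendsto' (hv.comp hsub)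
        ((l₁.mul ((hΦc.tendsto t₁).comp m₁)).add (l₂.mul ((hΦc.tendsto t₂).comp m₂)))
        fun n => hval _
  -- The longer tent escapes: its mass bound forces its height, and by `hΦlim` its objective value,
  -- to zero.
  · push Not at hR
    have hs₂ : Tendsto s₂ atTop atTop := by
      refine tendsto_atTop.2 fun R => ?_
      filter_upwards [hR R] with n hn using hn.le
    obtain ⟨⟨x, t⟩, -, ψ, hψ, hlim⟩ := (isCompact_Icc.prod isCompact_Icc).tendsto_subseq
      (x := fun n => (w₁ n, s₁ n)) (fun n => ⟨hw₁ n, hs₁ n⟩)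
    have hsub := hψ.tendsto_atTop
    have l : Tendsto (fun n => w₁ (ψ n)) atTop (𝓝 x) := hlim.fst_nhds
    have m : Tendsto (fun n => s₁ (ψ n)) atTop (𝓝 t) := hlim.snd_nhds
    have hmass : ∀ n, w₂ n * s₂ n ^ 2 ≤ 2 * B := fun n => by
      have := (hc n).mass
      have := hB n
      have := mul_nonneg (hc n).w₁_nonneg (sq_nonneg (s₁ n))
      linarith
    have z₁ : Tendsto (fun n => w₂ n * s₂ n) atTop (𝓝 0) := by
      refine squeeze_zero' ?_ ?_ (hs₂.const_div_atTop (2 * B))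
      · exact Eventually.of_forall fun n =>
          mul_nonneg (hc n).w₂_nonneg ((hc n).s₁_nonneg.trans (hc n).s₁_le)
      · filter_upwards [hs₂.eventually_gt_atTop 0] with n hn
        rw [le_div_iff₀ hn]
        have := hmass n
        linarith
    have z₂ : Tendsto (fun n => w₂ n * Φ (s₂ n)) atTop (𝓝 0) := by
      have h1 := (hΦlim.comp hs₂).const_mul (2 * B)
      rw [mul_zero] at h1
      refine squeeze_zero' ?_ ?_ h1
      · exact Eventually.of_forall fun n => mul_nonneg (hc n).w₂_nonneg (hΦnn _)
      · filter_upwards [hs₂.eventually_gt_atTop 0] with n hn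
        have e : w₂ n * Φ (s₂ n) = w₂ n * s₂ n ^ 2 * (Φ (s₂ n) / s₂ n ^ 2) := by
          field_simp
        rw [e]
        exact mul_le_mul_of_nonneg_right (hmass n) (div_nonneg (hΦnn _) (sq_nonneg _))
    have hx0 : 0 ≤ x := ge_of_tendsto' l fun n => (hc _).w₁_nonneg
    have ht0 : 0 ≤ t := ge_of_tendsto' m fun n => (hc _).s₁_nonneg
    have hxν : x ≤ ν := le_of_tendsto' l fun n => (hw₁ _).2
    have hxt : x * t = η := by
      have h1 : Tendsto (fun n => w₁ (ψ n) * s₁ (ψ n) + w₂ (ψ n) * s₂ (ψ n)) atTop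
        (𝓝 (x * t + 0)) := (l.mul m).add (z₁.comp hsub)
      rw [add_zero] at h1
      exact tendsto_nhds_unique h1 (tendsto_const_nhds.congr fun n => (hc _).value.symm)
    have hxt2 : x * t ^ 2 ≤ 2 * β := by
      refine le_of_tendsto_of_tendsto' (l.mul (m.pow 2)) ((hb.comp hsub).const_mul 2) fun n => ?_
      have := (hc (ψ n)).mass
      have := mul_nonneg (hc (ψ n)).w₂_nonneg (sq_nonneg (s₂ (ψ n)))
      simp only [Function.comp]
      linarith
    have hV : V ≤ x * Φ t := by
      have h1 := (l.mul ((hΦc.tendsto t).comp m)).add (z₂.comp hsub)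
      rw [add_zero] at h1
      exact le_of_tendsto_of_tendsto' (hv.comp hsub) h1 fun n => hval _
    have hηt : η * t ≤ 2 * β := by rw [← hxt]; linarith
    refine ⟨_, _, _, _, isTwoTent_single (ν := ν) hη hβ ?_, ?_⟩
    -- The slope of the lengthened tent is admissible because `η² = x (x t²) ≤ ν (2β)`.
    · have e : η ^ 2 = x * (x * t ^ 2) := by rw [← hxt]; ring
      rw [e]
      calc x * (x * t ^ 2) ≤ ν * (2 * β) :=
            mul_le_mul hxν hxt2 (by positivity) (hx0.trans hxν)
        _ = 2 * β * ν := by ring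
    · set s := 2 * β / η with hs
      have hspos : 0 < s := by positivity
      have hts : t ≤ s := by rw [hs, le_div_iff₀ hη]; linarith
      -- Convexity between `0` and `s`, with `Φ 0 = 0`.
      have h1 : Φ t ≤ t / s * Φ s := by
        have h2 := hΦ.2 (mem_univ s) (mem_univ 0) (div_nonneg ht0 hspos.le)
          (sub_nonneg.2 ((div_le_one hspos).2 hts)) (by ring)
        simp only [smul_eq_mul, hΦ0, mul_zero, add_zero] at h2
        rwa [div_mul_cancel₀ _ hspos.ne'] at h2
      have e : x * (t / s * Φ s) = η ^ 2 / (2 * β) * Φ s := by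
        rw [← mul_assoc, ← mul_div_assoc, hxt, hs]
        field_simp
      have h3 := mul_le_mul_of_nonneg_left h1 hx0
      linarith

/-! ### Shape of feasible tails -/

lemma not_integrableOn_Ici_of_le {a y δ : ℝ} {f : ℝ → ℝ} (hay : a ≤ y) (hδ : 0 < δ)
    (hf : ∀ x, y ≤ x → δ ≤ f x) : ¬ IntegrableOn f (Ici a) := by
  intro hi
  have h1 : IntegrableOn (fun _ : ℝ => δ) (Ici y) := by
    refine (hi.mono_set (Ici_subset_Ici.2 hay)).mono' aestronglyMeasurable_const ?_
    filter_upwards [ae_restrict_mem measurableSet_Ici] with x hx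
    rw [Real.norm_eq_abs, abs_of_pos hδ]
    exact hf x hx
  rw [integrableOn_const_iff] at h1
  simp [hδ.ne'] at h1

/-- The line through `(p, f p)` and `(q, f q)`. -/
noncomputable def chord (f : ℝ → ℝ) (p q x : ℝ) : ℝ := f p + (f q - f p) / (q - p) * (x - p)

section Chord

variable {a p q x : ℝ} {f : ℝ → ℝ}

lemma chord_right (hpq : p < q) : chord f p q q = f q := by
  unfold chord
  rw [div_mul_cancel₀ _ (sub_pos.2 hpq).ne']; ring

lemma le_chord (hf : ConvexOn ℝ (Ici a) f) (hap : a ≤ p) (hx : x ∈ Icc p q) :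
    f x ≤ chord f p q x := by
  rcases hx.1.eq_or_lt with rfl | h1
  · simp [chord]
  rcases hx.2.eq_or_lt with rfl | h2
  · rw [chord_right h1]
  have h3 := hf.secant_mono_aux1 (show p ∈ Ici a from hap)
    (show q ∈ Ici a from hap.trans (h1.le.trans h2.le)) h1 h2
  have h4 : 0 < q - p := by linarith
  have e : chord f p q x = ((q - x) * f p + (x - p) * f q) / (q - p) := by
    unfold chord; field_simp; ring
  rw [e, le_div_iff₀ h4]
  linarith

lemma chord_le (hf : ConvexOn ℝ (Ici a) f) (hap : a ≤ p) (hpq : p < q) (hx : a ≤ x)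
    (hx' : x ∉ Ioo p q) : chord f p q x ≤ f x := by
  have h4 : 0 < q - p := by linarith
  rcases lt_trichotomy x p with h | rfl | h
  · have h3 := hf.secant_mono_aux1 (show x ∈ Ici a from hx)
      (show q ∈ Ici a from hap.trans hpq.le) h hpq
    have e : chord f p q x = ((q - x) * f p - (p - x) * f q) / (q - p) := by
      unfold chord; field_simp; ring
    rw [e, div_le_iff₀ h4]
    linarith
  · simp [chord]
  · have hq : q ≤ x := by
      by_contra hlt
      exact hx' ⟨h, not_le.1 hlt⟩
    rcases hq.eq_or_lt with rfl | hq
    · rw [chord_right hpq]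
    have h3 := hf.secant_mono_aux1 (show p ∈ Ici a from hap)
      (show x ∈ Ici a from hx) hpq hq
    have e : chord f p q x = ((x - p) * f q - (x - q) * f p) / (q - p) := by
      unfold chord; field_simp; ring
    rw [e, div_le_iff₀ h4]
    linarith

end Chord

section Feasible

variable {a β η ν : ℝ} {f : ℝ → ℝ}

/-- After a rise, the extended chord would keep `f` above a positive constant, against
integrability. -/
lemma IsFeasible.antitoneOn (hf : IsFeasible a β η ν f) : AntitoneOn f (Ici a) := by
  intro x hx y hy hxy
  by_contra! hlt
  have hxy' : x < y := hxy.lt_of_ne (by rintro rfl; exact lt_irrefl _ hlt)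
  refine not_integrableOn_Ici_of_le (δ := f y) hy ((hf.nonneg x hx).trans_lt hlt) ?_ hf.integrableOn
  intro z hz
  have h1 := chord_le hf.convexOn hx hxy' (le_trans hy hz) (fun h => not_lt.2 hz h.2)
  have h2 : f y ≤ chord f x y z := by
    have h3 : 0 < (f y - f x) / (y - x) := div_pos (by linarith) (by linarith)
    have h4 := chord_right (f := f) hxy'
    unfold chord at h4 ⊢
    nlinarith [mul_nonneg h3.le (sub_nonneg.2 hz)]
  exact h2.trans h1

lemma IsFeasible.continuousOn (hf : IsFeasible a β η ν f) : ContinuousOn f (Ici a) := by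
  intro x hx
  rcases (mem_Ici.1 hx).eq_or_lt with rfl | hx
  · have h := hf.right_limit
    rw [← hf.value_eq] at h
    exact continuousWithinAt_Ioi_iff_Ici.1 h
  · have h := hf.convexOn.continuousOn_interior
    rw [interior_Ici] at h
    exact (h.continuousAt (Ioi_mem_nhds hx)).continuousWithinAt

/-- `d` is the right derivative at `a`; convexity gives the support line, and `d ≥ 0` would keep `f`
above `η`. -/
lemma IsFeasible.exists_tangent (hη : 0 < η) (hf : IsFeasible a β η ν f) :
    ∃ d : ℝ, -ν ≤ d ∧ d < 0 ∧ ∀ x, a ≤ x → η + d * (x - a) ≤ f x := by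
  obtain ⟨d, hd, hdν⟩ := hf.right_deriv
  have ht : ∀ x, a ≤ x → η + d * (x - a) ≤ f x := by
    intro x hx
    rcases hx.eq_or_lt with rfl | hx
    · simp [hf.value_eq]
    have h := hf.convexOn.le_slope_of_hasDerivWithinAt_Ioi self_mem_Ici hx.le hx hd
    rw [slope_def_field, le_div_iff₀ (sub_pos.2 hx), hf.value_eq] at h
    linarith
  refine ⟨d, hdν, ?_, ht⟩
  by_contra! hd0
  refine not_integrableOn_Ici_of_le (δ := η) le_rfl hη (fun x hx => ?_) hf.integrableOn
  exact le_trans (by nlinarith) (ht x hx)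

lemma IsFeasible.le_value (hf : IsFeasible a β η ν f) {x : ℝ} (hx : a ≤ x) : f x ≤ η := by
  rw [← hf.value_eq]
  exact hf.antitoneOn self_mem_Ici hx hx

/-- If a chord is horizontal, it is the zero line. -/
lemma IsFeasible.eq_zero_of_eq (hf : IsFeasible a β η ν f) {p q : ℝ} (hap : a ≤ p) (hpq : p < q)
    (h : f p = f q) : f p = 0 := by
  by_contra hne
  have hpos : 0 < f p := lt_of_le_of_ne (hf.nonneg p hap) (Ne.symm hne)
  refine not_integrableOn_Ici_of_le (y := q) (hap.trans hpq.le) hpos (fun x hx => ?_)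
    hf.integrableOn
  have := chord_le hf.convexOn hap hpq (hap.trans (hpq.le.trans hx)) (fun h => not_lt.2 hx h.2)
  simpa [chord, h] using this

end Feasible

/-! ### Two lines as two tents -/

/-- The positive part of the maximum of two decreasing lines is a sum of two tents. -/
lemma exists_max_eq_twoTent {η ν d k m : ℝ} (a : ℝ) (hη : 0 < η) (hd : d < 0) (hdν : -ν ≤ d)
    (hkη : k ≤ η) (hm : m ≤ 0) (hm0 : m = 0 → k = 0) :
    ∃ w₁ s₁ w₂ s₂ : ℝ,
      IsTwoTent η ν ((w₁ * s₁ ^ 2 + w₂ * s₂ ^ 2) / 2) w₁ s₁ w₂ s₂ ∧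
      ∀ x, a ≤ x → max (max (η + d * (x - a)) (k + m * (x - a))) 0 = twoTent a w₁ s₁ w₂ s₂ x := by
  have hd' : 0 < -d := by linarith
  -- Compare the zeros of the lines. If the second vanishes no later than the first, then, as `k ≤
  -- η`, it is never the larger where positive, and one tent suffices.
  by_cases hcase : m = 0 ∨ k / -m ≤ η / -d
  · refine ⟨-d, η / -d, 0, η / -d, ⟨hd'.le, le_rfl, by positivity, le_rfl, by linarith, ?_, ?_⟩, ?_⟩
    · rw [mul_div_cancel₀ _ hd'.ne']; ring
    · ring
    · intro x hx
      have h1 : max (max (η + d * (x - a)) (k + m * (x - a))) 0 = max (η + d * (x - a)) 0 := by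
        apply le_antisymm
        · refine max_le (max_le (le_max_left _ _) ?_) (le_max_right _ _)
          rcases hcase with h0 | h0
          · rw [hm0 h0, h0]; simp
          · rcases hm.eq_or_lt with h00 | h00
            · rw [hm0 h00, h00]; simp
            have hm' : 0 < -m := by linarith
            rw [div_le_div_iff₀ hm' hd'] at h0
            by_contra! hlt
            obtain ⟨hl1, hl2⟩ := max_lt_iff.1 hlt
            have hy : 0 ≤ x - a := by linarith
            rcases le_or_gt (m - d) 0 with hmd | hmd
            · nlinarith [mul_nonneg hy (neg_nonneg.2 hmd)]
            · have e1 := mul_lt_mul_of_pos_right hl1 hm'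
              have e2 := mul_lt_mul_of_pos_left hl2 hmd
              nlinarith
        · exact max_le ((le_max_left _ _).trans (le_max_left _ _)) (le_max_right _ _)
      rw [h1]
      simp only [twoTent, tent, zero_mul, add_zero]
      rw [mul_max_of_nonneg _ _ hd'.le, mul_zero, mul_sub (-d), mul_div_cancel₀ _ hd'.ne']
      congr 1
      ring
  · push Not at hcase
    obtain ⟨hmne, h0⟩ := hcase
    have hm' : 0 < -m := by
      have := lt_of_le_of_ne hm hmne
      linarith
    rw [div_lt_div_iff₀ hd' hm'] at h0
    have hdm : 0 < m - d := by
      by_contra! hle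
      nlinarith [mul_le_mul_of_nonneg_right hkη hd'.le, mul_nonneg hη.le (by linarith : 0 ≤ d - m)]
    have hle : (η - k) / (m - d) ≤ k / -m := by
      rw [div_le_div_iff₀ hdm hm']
      nlinarith
    -- From `max L₁ L₂ = L₂ + (L₁ - L₂)₊`: the first tent ends where the lines cross, the second
    -- where the flatter line vanishes.
    refine ⟨m - d, (η - k) / (m - d), -m, k / -m, ⟨hdm.le, hm'.le, div_nonneg (by linarith) hdm.le,
      hle, by linarith, ?_, by ring⟩, ?_⟩
    · rw [mul_div_cancel₀ _ hdm.ne', mul_div_cancel₀ _ hm'.ne']; ring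
    · intro x hx
      have e1 : (m - d) * tent a ((η - k) / (m - d)) x
          = max (η + d * (x - a) - (k + m * (x - a))) 0 := by
        rw [tent, mul_max_of_nonneg _ _ hdm.le, mul_zero, mul_sub, mul_div_cancel₀ _ hdm.ne']
        congr 1
        ring
      have e2 : -m * tent a (k / -m) x = max (k + m * (x - a)) 0 := by
        rw [tent, mul_max_of_nonneg _ _ hm'.le, mul_zero, mul_sub, mul_div_cancel₀ _ hm'.ne']
        congr 1
        ring
      rw [twoTent, e1, e2]
      rcases le_total (x - a) (k / -m) with hx1 | hx1
      · have h2 : 0 ≤ k + m * (x - a) := by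
          rw [le_div_iff₀ hm'] at hx1; linarith
        rw [max_eq_left h2, max_eq_left (h2.trans (le_max_right _ _)), ← max_add_add_right]
        simp
      · have h2 : k + m * (x - a) ≤ 0 := by
          rw [div_le_iff₀ hm'] at hx1; linarith
        have h3 : η + d * (x - a) - (k + m * (x - a)) ≤ 0 := by
          have := hle.trans hx1
          rw [div_le_iff₀ hdm] at this; linarith
        rw [max_eq_right h2, max_eq_right h3, max_eq_right (max_le (by linarith) h2), add_zero]

/-! ### Exchange argument -/

/-- Away from the exceptional point `c`, the values of `h` on `(p, q)` dominate those outside. -/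
def Separates (a c : ℝ) (h : ℝ → ℝ) (p q : ℝ) : Prop :=
  ∀ x, a ≤ x → x ≠ c → x ∉ Icc p q → ∀ y ∈ Ioo p q, y ≠ c → h x ≤ h y

/-- With `r` the infimum of `h` inside, `(h - r)(g - f) ≥ 0` almost everywhere. Hence `∫ h (g - f) ≥
r ∫ (g - f) ≥ 0`. -/
lemma Separates.objective_le {a c p q C : ℝ} {h f g : ℝ → ℝ} (hs : Separates a c h p q)
    (hpq : p < q) (hmeas : Measurable h) (hnn : ∀ x, 0 ≤ h x) (hC : ∀ x, h x ≤ C)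
    (hf : IntegrableOn f (Ici a)) (hg : IntegrableOn g (Ici a))
    (hin : ∀ x, a ≤ x → x ∈ Icc p q → f x ≤ g x) (hout : ∀ x, a ≤ x → x ∉ Icc p q → g x ≤ f x)
    (hfg : ∫ x in Ici a, f x ≤ ∫ x in Ici a, g x) : objective a h f ≤ objective a h g := by
  set S : Set ℝ := h '' (Ioo p q \ {c}) with hS
  have hSne : S.Nonempty :=
    (((Ioo_infinite hpq).sdiff (finite_singleton c)).nonempty).image h
  have hSb : BddBelow S := ⟨0, by rintro _ ⟨x, -, rfl⟩; exact hnn x⟩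
  set r := sInf S with hr
  have hr0 : 0 ≤ r := le_csInf hSne (by rintro _ ⟨x, -, rfl⟩; exact hnn x)
  have hif := integrableOn_mul_of_bounded hmeas hnn hC hf
  have hig := integrableOn_mul_of_bounded hmeas hnn hC hg
  have key : ∫ x in Ici a, (r * g x - r * f x) ≤ ∫ x in Ici a, (h x * g x - h x * f x) := by
    refine integral_mono_ae ((hg.const_mul r).sub (hf.const_mul r)) (hig.sub hif) ?_
    have hne : ∀ᵐ x ∂(volume.restrict (Ici a)), x ∉ ({c, p, q} : Set ℝ) :=
      ae_restrict_of_ae ((Set.toFinite _).countable.ae_notMem volume)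
    filter_upwards [ae_restrict_mem measurableSet_Ici, hne] with x hx hx'
    simp only [mem_insert_iff, mem_singleton_iff, not_or] at hx'
    obtain ⟨hxc, hxp, hxq⟩ := hx'
    suffices 0 ≤ (h x - r) * (g x - f x) by linarith
    by_cases hxI : x ∈ Icc p q
    · refine mul_nonneg (sub_nonneg.2 (csInf_le hSb ⟨x, ⟨⟨?_, ?_⟩, hxc⟩, rfl⟩))
        (sub_nonneg.2 (hin x hx hxI))
      · exact lt_of_le_of_ne hxI.1 (Ne.symm hxp)
      · exact lt_of_le_of_ne hxI.2 hxq
    · refine mul_nonneg_of_nonpos_of_nonpos (sub_nonpos.2 (le_csInf hSne ?_))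
        (sub_nonpos.2 (hout x hx hxI))
      rintro _ ⟨y, hy, rfl⟩
      exact hs x hx hxc hxI y hy.1 hy.2
  rw [integral_sub (hg.const_mul r) (hf.const_mul r), integral_sub hig hif, integral_const_mul,
    integral_const_mul] at key
  have := mul_nonneg hr0 (sub_nonneg.2 hfg)
  unfold objective
  linarith

/-! ### Cuts of a feasible tail -/

/-- The positive part of the maximum of the line of slope `d` through `(a, η)` and the chord of `f`
over `[p, q]`. -/
noncomputable def cut (a η d : ℝ) (f : ℝ → ℝ) (p q x : ℝ) : ℝ :=
  max (max (η + d * (x - a)) (chord f p q x)) 0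

section Cut

variable {a β η ν d p q : ℝ} {f : ℝ → ℝ}

lemma continuous_cut : Continuous (cut a η d f p q) := by
  unfold cut chord; fun_prop

lemma cut_nonneg (x : ℝ) : 0 ≤ cut a η d f p q x := le_max_right _ _

lemma le_cut (hf : IsFeasible a β η ν f) (hap : a ≤ p) {x : ℝ} (hx : x ∈ Icc p q) :
    f x ≤ cut a η d f p q x :=
  (le_chord hf.convexOn hap hx).trans ((le_max_right _ _).trans (le_max_left _ _))

lemma cut_le (hf : IsFeasible a β η ν f) (ht : ∀ x, a ≤ x → η + d * (x - a) ≤ f x)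
    (hap : a ≤ p) (hpq : p < q) {x : ℝ} (hx : a ≤ x) (hx' : x ∉ Icc p q) :
    cut a η d f p q x ≤ f x :=
  max_le (max_le (ht x hx) (chord_le hf.convexOn hap hpq hx fun h => hx' ⟨h.1.le, h.2.le⟩))
    (hf.nonneg x hx)

/-- Serves both to bound the excess mass by `η (q - p)` and to dominate all cuts along a path. -/
lemma cut_le_add (hf : IsFeasible a β η ν f) (ht : ∀ x, a ≤ x → η + d * (x - a) ≤ f x)
    (hη : 0 < η) (hap : a ≤ p) (hpq : p < q) {x : ℝ} (hx : a ≤ x) :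
    cut a η d f p q x ≤ f x + (Icc p q).indicator (fun _ => η) x := by
  by_cases h : x ∈ Icc p q
  · rw [indicator_of_mem h]
    have h0 := hf.nonneg x hx
    have h1 : cut a η d f p q x ≤ η := by
      refine max_le (max_le ((ht x hx).trans (hf.le_value hx)) ?_) hη.le
      have h2 := hf.antitoneOn hap (show q ∈ Ici a from hap.trans hpq.le) hpq.le
      have h3 : (f q - f p) / (q - p) ≤ 0 :=
        div_nonpos_of_nonpos_of_nonneg (by linarith) (by linarith)
      have h4 := mul_nonpos_of_nonpos_of_nonneg h3 (sub_nonneg.2 h.1)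
      have h5 := hf.le_value hap
      unfold chord
      linarith
    linarith
  · rw [indicator_of_notMem h, add_zero]
    exact cut_le hf ht hap hpq hx h

lemma integrable_indicator_Icc (u v η : ℝ) :
    Integrable ((Icc u v).indicator (fun _ => η)) volume :=
  (integrable_indicator_iff measurableSet_Icc).2 (by simp [integrableOn_const_iff])

lemma integrableOn_cut (hf : IsFeasible a β η ν f) (ht : ∀ x, a ≤ x → η + d * (x - a) ≤ f x)
    (hη : 0 < η) (hap : a ≤ p) (hpq : p < q) : IntegrableOn (cut a η d f p q) (Ici a) := by
  refine (hf.integrableOn.add (integrable_indicator_Icc p q η).integrableOn).mono'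
    continuous_cut.aestronglyMeasurable ?_
  filter_upwards [ae_restrict_mem measurableSet_Ici] with x hx
  rw [Real.norm_eq_abs, abs_of_nonneg (cut_nonneg x)]
  exact cut_le_add hf ht hη hap hpq hx

lemma integral_cut_le (hf : IsFeasible a β η ν f) (ht : ∀ x, a ≤ x → η + d * (x - a) ≤ f x)
    (hη : 0 < η) (hap : a ≤ p) (hpq : p < q) :
    ∫ x in Ici a, cut a η d f p q x ≤ β + η * (q - p) := by
  have hi := (integrable_indicator_Icc p q η).integrableOn (s := Ici a)
  have h1 : ∫ x in Ici a, cut a η d f p q x ≤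
      ∫ x in Ici a, (f x + (Icc p q).indicator (fun _ => η) x) := by
    refine setIntegral_mono_on (integrableOn_cut hf ht hη hap hpq) (hf.integrableOn.add hi)
      measurableSet_Ici fun x hx => cut_le_add hf ht hη hap hpq hx
  rw [integral_add hf.integrableOn hi, hf.integral_eq, setIntegral_indicator measurableSet_Icc,
    inter_eq_self_of_subset_right (show Icc p q ⊆ Ici a from fun x hx => hap.trans hx.1), setIntegral_const] at h1
  simp only [smul_eq_mul, Real.volume_real_Icc_of_le hpq.le] at h1
  linarith

lemma exists_cut_eq_twoTent (hf : IsFeasible a β η ν f)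
    (hη : 0 < η) (hd : d < 0) (hdν : -ν ≤ d)
    (hap : a ≤ p) (hpq : p < q) :
    ∃ w₁ s₁ w₂ s₂ : ℝ,
      IsTwoTent η ν (∫ x in Ici a, cut a η d f p q x) w₁ s₁ w₂ s₂ ∧
      ∀ x, a ≤ x → cut a η d f p q x = twoTent a w₁ s₁ w₂ s₂ x := by
  have h2 := hf.antitoneOn hap (show q ∈ Ici a from hap.trans hpq.le) hpq.le
  have hline : ∀ x, chord f p q x = chord f p q a + (f q - f p) / (q - p) * (x - a) := by
    intro x; unfold chord; ring
  obtain ⟨w₁, s₁, w₂, s₂, hc, heq⟩ := exists_max_eq_twoTent (k := chord f p q a)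
    (m := (f q - f p) / (q - p)) a hη hd hdν
    (by
      rw [← hf.value_eq]
      exact chord_le hf.convexOn hap hpq le_rfl fun h => not_lt.2 hap h.1)
    (div_nonpos_of_nonpos_of_nonneg (by linarith) (by linarith))
    (by
      intro h0
      rcases div_eq_zero_iff.1 h0 with h | h
      · have := hf.eq_zero_of_eq hap hpq (by linarith)
        simp [chord, this, show f q = 0 by linarith]
      · linarith)
  have heq' : ∀ x, a ≤ x → cut a η d f p q x = twoTent a w₁ s₁ w₂ s₂ x := by
    intro x hx
    rw [← heq x hx, ← hline x]
    rfl
  refine ⟨w₁, s₁, w₂, s₂, ?_, heq'⟩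
  rw [setIntegral_congr_fun measurableSet_Ici heq',
    integral_twoTent a w₁ w₂ hc.s₁_nonneg (hc.s₁_nonneg.trans hc.s₁_le)]
  exact hc

/-- If a path of separating intervals `[P t, P t + t]` reaches a cut of mass at least `β`, then
`f` is dominated by a sum of two tents whose mass is at least `β` and as close to `β` as desired. -/
lemma exists_twoTent_of_path {c T C ε : ℝ} {h P : ℝ → ℝ} (hf : IsFeasible a β η ν f)
    (hη : 0 < η) (hmeas : Measurable h) (hnn : ∀ x, 0 ≤ h x) (hC : ∀ x, h x ≤ C) (hT : 0 < T)
    (hP : ContinuousOn P (Ioc 0 T)) (haP : ∀ t ∈ Ioc 0 T, a ≤ P t) (hPc : ∀ t ∈ Ioc 0 T, P t ≤ c)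
    (hsep : ∀ t ∈ Ioc 0 T, Separates a c h (P t) (P t + t))
    (hend : ∀ d, (∀ x, a ≤ x → η + d * (x - a) ≤ f x) →
      β ≤ ∫ x in Ici a, cut a η d f (P T) (P T + T) x) (hε : 0 < ε) :
    ∃ b w₁ s₁ w₂ s₂ : ℝ, β ≤ b ∧ b ≤ β + ε ∧ IsTwoTent η ν b w₁ s₁ w₂ s₂ ∧
      objective a h f ≤ w₁ * tentValue a h s₁ + w₂ * tentValue a h s₂ := by
  obtain ⟨d, hdν, hd, ht⟩ := hf.exists_tangent hη
  set G : ℝ → ℝ := fun t => ∫ x in Ici a, cut a η d f (P t) (P t + t) x with hG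
  suffices ∃ t ∈ Ioc 0 T, β ≤ G t ∧ G t ≤ β + ε by
    obtain ⟨t, htT, h1, h2⟩ := this
    have hap := haP t htT
    have hpq : P t < P t + t := by linarith [htT.1]
    obtain ⟨w₁, s₁, w₂, s₂, hc, heq⟩ := exists_cut_eq_twoTent hf hη hd hdν hap hpq
    refine ⟨_, w₁, s₁, w₂, s₂, h1, h2, hc, ?_⟩
    rw [← objective_twoTent hmeas hnn hC]
    have h3 : objective a h (twoTent a w₁ s₁ w₂ s₂)
        = objective a h (cut a η d f (P t) (P t + t)) :=
      setIntegral_congr_fun measurableSet_Ici fun x hx => by simp only [heq x hx]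
    rw [h3]
    refine (hsep t htT).objective_le hpq hmeas hnn hC hf.integrableOn
      (integrableOn_cut hf ht hη hap hpq) (fun x _ hxI => le_cut hf hap hxI)
      (fun x hx hxI => cut_le hf ht hap hpq hx hxI) ?_
    rw [hf.integral_eq]
    exact h1
  -- Dominated convergence: all the intervals lie in `[a, c + T]`.
  have hGc : ContinuousOn G (Ioc 0 T) := by
    refine continuousOn_of_dominated
      (bound := fun x => f x + (Icc a (c + T)).indicator (fun _ => η) x)
      (fun t _ => continuous_cut.aestronglyMeasurable) ?_
      (hf.integrableOn.add (integrable_indicator_Icc a (c + T) η).integrableOn) ?_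
    · intro t htT
      have hap := haP t htT
      filter_upwards [ae_restrict_mem measurableSet_Ici] with x hx
      rw [Real.norm_eq_abs, abs_of_nonneg (cut_nonneg x)]
      refine (cut_le_add hf ht hη hap (by linarith [htT.1]) hx).trans ?_
      have hsub : Icc (P t) (P t + t) ⊆ Icc a (c + T) :=
        Icc_subset_Icc hap (add_le_add (hPc t htT) htT.2)
      have := indicator_le_indicator_of_subset hsub (f := fun _ => η) (fun _ => hη.le) x
      linarith
    · refine Eventually.of_forall fun x => ?_
      have c1 : ContinuousOn (fun t => f (P t)) (Ioc 0 T) := hf.continuousOn.comp hP haP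
      have c2 : ContinuousOn (fun t => f (P t + t)) (Ioc 0 T) :=
        hf.continuousOn.comp (hP.add continuousOn_id) fun t htT =>
          (haP t htT).trans (by simpa using htT.1.le)
      unfold cut chord
      refine (continuousOn_const.sup (c1.add (((c2.sub c1).div ?_ ?_).mul ?_))).sup
        continuousOn_const
      · exact (hP.add continuousOn_id).sub hP
      · intro t htT
        have := htT.1
        simpa using this.ne'
      · exact continuousOn_const.sub hP
  -- At length `t₀` the excess mass is at most `η t₀ ≤ ε`. So either `t₀` works, or the mass there
  -- is below `β` and equals `β` at some length in `[t₀, T]`. Length zero is avoided because the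
  -- chord degenerates.
  set t₀ := min T (ε / η) with ht₀
  have ht₀T : t₀ ∈ Ioc 0 T := ⟨lt_min hT (by positivity), min_le_left _ _⟩
  rcases le_or_gt β (G t₀) with hβ | hβ
  · refine ⟨t₀, ht₀T, hβ, ?_⟩
    have h1 := integral_cut_le hf ht hη (haP t₀ ht₀T) (show P t₀ < P t₀ + t₀ by linarith [ht₀T.1])
    have h2 : η * t₀ ≤ ε := by
      have := mul_le_mul_of_nonneg_left (min_le_right T (ε / η)) hη.le
      rwa [mul_div_cancel₀ _ hη.ne'] at this
    have h3 : G t₀ ≤ β + η * (P t₀ + t₀ - P t₀) := h1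
    rw [add_sub_cancel_left] at h3
    linarith
  · obtain ⟨t, htT, hGt⟩ := intermediate_value_Icc ht₀T.2
      (hGc.mono fun t htT => ⟨ht₀T.1.trans_le htT.1, htT.2⟩) ⟨hβ.le, hend d ht⟩
    exact ⟨t, ⟨ht₀T.1.trans_le htT.1, htT.2⟩, hGt.ge, by rw [hGt]; linarith⟩

end Cut

/-! ### Level intervals of a unimodal function -/

section Path

variable {a c : ℝ} {h : ℝ → ℝ}

/-- Candidates for the left end of an upper level interval of `h` of length `t`. -/
def leftEndSet (a c : ℝ) (h : ℝ → ℝ) (t : ℝ) : Set ℝ :=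
  {u | u ∈ Icc (max a (c - t)) c ∧ (u = c ∨ (c < u + t ∧ h (u + t) ≤ h u))}

/-- The left end of an upper level interval of length `t` of a function `h` with mode `c`. -/
noncomputable def leftEnd (a c : ℝ) (h : ℝ → ℝ) (t : ℝ) : ℝ := sInf (leftEndSet a c h t)

lemma mode_mem_leftEndSet (hac : a ≤ c) {t : ℝ} (ht : 0 ≤ t) : c ∈ leftEndSet a c h t :=
  ⟨⟨max_le hac (by linarith), le_rfl⟩, Or.inl rfl⟩

lemma bddBelow_leftEndSet (t : ℝ) : BddBelow (leftEndSet a c h t) :=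
  ⟨max a (c - t), fun _ hu => hu.1.1⟩

lemma le_leftEnd (hac : a ≤ c) {t : ℝ} (ht : 0 ≤ t) : max a (c - t) ≤ leftEnd a c h t :=
  le_csInf ⟨c, mode_mem_leftEndSet hac ht⟩ fun _ hu => hu.1.1

lemma leftEnd_le (hac : a ≤ c) {t : ℝ} (ht : 0 ≤ t) : leftEnd a c h t ≤ c :=
  csInf_le (bddBelow_leftEndSet t) (mode_mem_leftEndSet hac ht)

lemma lt_of_lt_leftEnd {t u : ℝ} (hac : a ≤ c) (ht : 0 ≤ t) (h1 : max a (c - t) < u)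
    (h2 : u < leftEnd a c h t) : h u < h (u + t) := by
  by_contra! hle
  refine notMem_of_lt_csInf h2 (bddBelow_leftEndSet t)
    ⟨⟨h1.le, h2.le.trans (leftEnd_le hac ht)⟩, Or.inr ⟨?_, hle⟩⟩
  linarith [(max_lt_iff.1 h1).2]

/-- While `[u, u + t]` straddles `c`, `h (u + t) - h u` is non-increasing in `u`; once non-positive,
it stays so. -/
lemma le_of_leftEnd_lt {t u : ℝ} (hac : a ≤ c) (hmono : MonotoneOn h (Ico a c))
    (hanti : AntitoneOn h (Ioi c)) (ht : 0 ≤ t) (h1 : leftEnd a c h t < u) (h2 : u < c) :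
    h (u + t) ≤ h u := by
  obtain ⟨v, ⟨hv, hv'⟩, hvu⟩ := exists_lt_of_csInf_lt ⟨c, mode_mem_leftEndSet hac ht⟩ h1
  rcases hv' with rfl | ⟨h3, h4⟩
  · exact absurd hvu (not_lt.2 h2.le)
  · have hav : a ≤ v := (le_max_left _ _).trans hv.1
    have e1 : h (u + t) ≤ h (v + t) :=
      hanti (mem_Ioi.2 h3) (mem_Ioi.2 (by linarith)) (by linarith)
    have e2 : h v ≤ h u := hmono ⟨hav, hvu.trans h2⟩ ⟨hav.trans hvu.le, h2⟩ hvu.le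
    linarith

/-- On the same side of `c`, unimodality decides. On opposite sides, compare through `h u` and `h (u
+ t)` for a `u` slightly beside the left end, where their order is known; no continuity of `h` is
needed. -/
lemma separates_leftEnd {t : ℝ} (hac : a ≤ c) (hmono : MonotoneOn h (Ico a c))
    (hanti : AntitoneOn h (Ioi c)) (ht : 0 < t) :
    Separates a c h (leftEnd a c h t) (leftEnd a c h t + t) := by
  have hlow : max a (c - t) ≤ leftEnd a c h t := le_leftEnd hac ht.le
  have hup : leftEnd a c h t ≤ c := leftEnd_le hac ht.le
  obtain ⟨hla, hlc⟩ := max_le_iff.1 hlow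
  intro x hax hxc hx y hy hyc
  rcases lt_or_ge x (leftEnd a c h t) with hxp | hxp
  · rcases lt_or_gt_of_ne hyc with hyc | hyc
    · exact hmono ⟨hax, by linarith⟩ ⟨by linarith [hy.1], hyc⟩ (by linarith [hy.1])
    · obtain ⟨u, hu1, hu2⟩ := exists_between
        (show max (max (max a (c - t)) x) (y - t) < leftEnd a c h t by
          refine max_lt (max_lt (max_lt (hax.trans_lt hxp) ?_) hxp) ?_
          · linarith [hy.2]
          · linarith [hy.2])
      obtain ⟨h12, h3⟩ := max_lt_iff.1 hu1
      obtain ⟨h1, h2⟩ := max_lt_iff.1 h12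
      have e1 := lt_of_lt_leftEnd hac ht.le h1 hu2
      have e2 : h x ≤ h u := hmono ⟨hax, by linarith⟩ ⟨by linarith, by linarith⟩ h2.le
      have e3 : h (u + t) ≤ h y := hanti hyc (mem_Ioi.2 (by linarith)) (by linarith)
      linarith
  · have hxq : leftEnd a c h t + t < x := by
      by_contra! hle
      exact hx ⟨hxp, hle⟩
    have hcx : c < x := by linarith
    rcases lt_or_gt_of_ne hyc with hyc | hyc
    · obtain ⟨u, hu1, hu2⟩ := exists_between
        (show leftEnd a c h t < min y (x - t) from lt_min hy.1 (by linarith))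
      obtain ⟨h1, h2⟩ := lt_min_iff.1 hu2
      have e1 := le_of_leftEnd_lt hac hmono hanti ht.le hu1 (h1.trans hyc)
      have e2 : h x ≤ h (u + t) := hanti (mem_Ioi.2 (by linarith)) hcx (by linarith)
      have e3 : h u ≤ h y := hmono ⟨by linarith, by linarith⟩ ⟨by linarith [hy.1], hyc⟩ h1.le
      linarith
    · exact hanti hyc hcx (by linarith [hy.2])

lemma leftEnd_antitone {t t' : ℝ} (hac : a ≤ c) (hanti : AntitoneOn h (Ioi c)) (ht : 0 ≤ t)
    (htt' : t ≤ t') : leftEnd a c h t' ≤ leftEnd a c h t := by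
  refine csInf_le_csInf (bddBelow_leftEndSet t') ⟨c, mode_mem_leftEndSet hac ht⟩ ?_
  rintro u ⟨hu, hu'⟩
  refine ⟨⟨le_trans (max_le_max le_rfl (by linarith)) hu.1, hu.2⟩, ?_⟩
  rcases hu' with h1 | ⟨h1, h2⟩
  · exact Or.inl h1
  · exact Or.inr ⟨by linarith,
      (hanti (mem_Ioi.2 h1) (mem_Ioi.2 (by linarith)) (by linarith)).trans h2⟩

/-- Shifting a candidate for `t'` right by `t' - t` keeps its right end and raises `h` at its left
end. With `leftEnd_antitone`, the level intervals are nested, so the left end is 1-Lipschitz. -/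
lemma leftEnd_le_add {t t' : ℝ} (hac : a ≤ c) (hmono : MonotoneOn h (Ico a c)) (ht : 0 ≤ t)
    (htt' : t ≤ t') : leftEnd a c h t ≤ leftEnd a c h t' + (t' - t) := by
  rw [← sub_le_iff_le_add]
  refine le_csInf ⟨c, mode_mem_leftEndSet hac (ht.trans htt')⟩ ?_
  rintro u ⟨hu, hu'⟩
  rw [sub_le_iff_le_add]
  rcases le_or_gt c (u + (t' - t)) with hc | hc
  · exact (leftEnd_le hac ht).trans hc
  obtain ⟨hua, huc⟩ := max_le_iff.1 hu.1
  rcases hu' with rfl | ⟨h1, h2⟩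
  · linarith
  refine csInf_le (bddBelow_leftEndSet t) ⟨⟨max_le (by linarith) (by linarith), hc.le⟩,
    Or.inr ⟨by linarith, ?_⟩⟩
  have e : u + (t' - t) + t = u + t' := by ring
  rw [e]
  exact h2.trans (hmono ⟨hua, by linarith⟩ ⟨by linarith, hc⟩ (by linarith))

lemma continuousOn_leftEnd (hac : a ≤ c) (hmono : MonotoneOn h (Ico a c))
    (hanti : AntitoneOn h (Ioi c)) : ContinuousOn (leftEnd a c h) (Ici 0) := by
  have key : ∀ t ∈ Ici (0 : ℝ), ∀ t' ∈ Ici (0 : ℝ), t ≤ t' →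
      |leftEnd a c h t - leftEnd a c h t'| ≤ |t - t'| := by
    intro t ht t' _ htt'
    have h1 := leftEnd_antitone hac hanti ht htt'
    have h2 := leftEnd_le_add hac hmono ht htt'
    rw [abs_of_nonneg (by linarith), abs_of_nonpos (by linarith)]
    linarith
  refine (LipschitzOnWith.of_dist_le_mul (K := 1) fun t ht t' ht' => ?_).continuousOn
  rw [Real.dist_eq, Real.dist_eq, NNReal.coe_one, one_mul]
  rcases le_total t t' with hle | hle
  · exact key t ht t' ht' hle
  · rw [abs_sub_comm, abs_sub_comm t]
    exact key t' ht' t ht hle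

end Path

/-! ### Domination by two tents -/

section Approximation

variable {a β η ν c C : ℝ} {h f : ℝ → ℝ}

/-- On the first half of the interval the chord is at least `f p / 2`, because it ends at a
non-negative value. -/
lemma mul_le_integral_cut {p t d : ℝ} (hf : IsFeasible a β η ν f) (hη : 0 < η)
    (hd : ∀ x, a ≤ x → η + d * (x - a) ≤ f x) (hap : a ≤ p) (ht : 0 < t) :
    t / 2 * (f p / 2) ≤ ∫ x in Ici a, cut a η d f p (p + t) x := by
  have hi := integrableOn_cut hf hd hη hap (show p < p + t by linarith)
  have hsub : Icc p (p + t / 2) ⊆ Ici a := fun x hx => hap.trans hx.1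
  have h1 : ∫ _x in Icc p (p + t / 2), f p / 2 ≤
      ∫ x in Icc p (p + t / 2), cut a η d f p (p + t) x := by
    refine setIntegral_mono_on continuousOn_const.integrableOn_Icc (hi.mono_set hsub)
      measurableSet_Icc fun x hx => ?_
    refine le_trans ?_ ((le_max_right _ _).trans (le_max_left _ _))
    have h2 := hf.nonneg (p + t) (by linarith)
    have h3 := hf.nonneg p hap
    have h4 : -(f p / t) ≤ (f (p + t) - f p) / (p + t - p) := by
      rw [add_sub_cancel_left, ← neg_div]
      gcongr
      linarith
    have h5 := mul_le_mul_of_nonneg_right h4 (sub_nonneg.2 hx.1)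
    have h6 : f p / t * (x - p) ≤ f p / t * (t / 2) :=
      mul_le_mul_of_nonneg_left (by linarith [hx.2]) (by positivity)
    have h7 : f p / t * (t / 2) = f p / 2 := by field_simp
    unfold chord
    linarith
  have h2 : ∫ x in Icc p (p + t / 2), cut a η d f p (p + t) x ≤
      ∫ x in Ici a, cut a η d f p (p + t) x :=
    setIntegral_mono_set hi (Eventually.of_forall fun x => cut_nonneg x) hsub.eventuallyLE
  rw [setIntegral_const, Real.volume_real_Icc_of_le (by linarith), smul_eq_mul] at h1
  calc t / 2 * (f p / 2) = (p + t / 2 - p) * (f p / 2) := by ring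
    _ ≤ _ := h1.trans h2

/-- Every feasible tail is dominated by a sum of two tents whose mass is at least `β` and as close
to `β` as desired. -/
lemma IsFeasible.exists_twoTent (hf : IsFeasible a β η ν f) (hβ : 0 < β) (hη : 0 < η)
    (hmeas : Measurable h) (hnn : ∀ x, 0 ≤ h x) (hC : ∀ x, h x ≤ C) (hac : a ≤ c)
    (hmono : MonotoneOn h (Ico a c)) (hanti : AntitoneOn h (Ioi c)) {ε : ℝ} (hε : 0 < ε) :
    ∃ b w₁ s₁ w₂ s₂ : ℝ, β ≤ b ∧ b ≤ β + ε ∧ IsTwoTent η ν b w₁ s₁ w₂ s₂ ∧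
      objective a h f ≤ w₁ * tentValue a h s₁ + w₂ * tentValue a h s₂ := by
  rcases (hf.nonneg c hac).eq_or_lt with hfc | hfc
  · have hac' : a < c := by
      refine hac.lt_of_ne ?_
      rintro rfl
      rw [hf.value_eq] at hfc
      exact hη.ne hfc
    have hf0 : ∀ x, c ≤ x → f x = 0 := fun x hx =>
      le_antisymm (hfc ▸ hf.antitoneOn hac (hac.trans hx) hx) (hf.nonneg x (hac.trans hx))
    -- If `f c = 0`, long level intervals need not carry mass `β`. Truncating `h` at `c` loses
    -- nothing for `f` and makes `[c - t, c]` level intervals; the last one, `[a, c]`, gives a cut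
    -- above all of `f`.
    set k : ℝ → ℝ := (Iio c).indicator h with hk
    have hkh : ∀ x, k x ≤ h x := indicator_le_self' fun x _ => hnn x
    have hknn : ∀ x, 0 ≤ k x := fun x => indicator_nonneg (fun x _ => hnn x) x
    have hkmeas : Measurable k := hmeas.indicator measurableSet_Iio
    have hkC : ∀ x, k x ≤ C := fun x => (hkh x).trans (hC x)
    obtain ⟨b, w₁, s₁, w₂, s₂, h1, h2, hc, h3⟩ := exists_twoTent_of_path (c := c) (T := c - a)
      (P := fun t => c - t) hf hη hkmeas hknn hkC (sub_pos.2 hac') (by fun_prop)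
      (fun t ht => by linarith [ht.2]) (fun t ht => by linarith [ht.1])
      (fun t ht x hax hxc hx y hy hyc => by
        rw [sub_add_cancel] at hx hy
        rcases lt_or_gt_of_ne hxc with hxc | hxc
        · have hxt : x < c - t := by
            by_contra! hle
            exact hx ⟨hle, hxc.le⟩
          rw [hk, indicator_of_mem (mem_Iio.2 hxc), indicator_of_mem (mem_Iio.2 hy.2)]
          exact hmono ⟨hax, hxc⟩ ⟨by linarith [hy.1], hy.2⟩ (by linarith [hy.1])
        · rw [hk, indicator_of_notMem (notMem_Iio.2 hxc.le)]
          exact hknn y)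
      (fun d hd => by
        simp only [sub_sub_cancel, add_sub_cancel]
        rw [← hf.integral_eq]
        refine setIntegral_mono_on hf.integrableOn (integrableOn_cut hf hd hη le_rfl hac')
          measurableSet_Ici fun x hx => ?_
        rcases le_or_gt x c with hxc | hxc
        · exact le_cut hf le_rfl ⟨hx, hxc⟩
        · rw [hf0 x hxc.le]
          exact cut_nonneg x) hε
    refine ⟨b, w₁, s₁, w₂, s₂, h1, h2, hc, ?_⟩
    have e : objective a h f = objective a k f := by
      unfold objective
      congr 1
      ext x
      rcases lt_or_ge x c with hxc | hxc
      · rw [hk, indicator_of_mem (mem_Iio.2 hxc)]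
      · rw [hf0 x hxc, mul_zero, mul_zero]
    have hle : ∀ s, tentValue a k s ≤ tentValue a h s := fun s =>
      integral_mono (integrableOn_mul_of_bounded hkmeas hknn hkC (integrableOn_tent a s))
        (integrableOn_mul_of_bounded hmeas hnn hC (integrableOn_tent a s))
        fun x => mul_le_mul_of_nonneg_right (hkh x) (tent_nonneg _ _ _)
    rw [e]
    exact h3.trans (add_le_add (mul_le_mul_of_nonneg_left (hle _) hc.w₁_nonneg)
      (mul_le_mul_of_nonneg_left (hle _) hc.w₂_nonneg))
  -- The left end is at most `c`, where `f ≥ f c`, so length `4β / f c` yields mass at least `β`.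
  · have hT : 0 < 4 * β / f c := by positivity
    have haP : ∀ t, 0 ≤ t → a ≤ leftEnd a c h t := fun t ht =>
      (le_max_left _ _).trans (le_leftEnd hac ht)
    refine exists_twoTent_of_path hf hη hmeas hnn hC hT
      ((continuousOn_leftEnd hac hmono hanti).mono fun t ht => ht.1.le)
      (fun t ht => haP t ht.1.le) (fun t ht => leftEnd_le hac ht.1.le)
      (fun t ht => separates_leftEnd hac hmono hanti ht.1) (fun d hd => ?_) hε
    refine le_trans ?_ (mul_le_integral_cut hf hη hd (haP _ hT.le) hT)
    have h1 := hf.antitoneOn (haP _ hT.le) hac (leftEnd_le (h := h) hac hT.le)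
    calc β = 4 * β / f c / 2 * (f c / 2) := by field_simp; ring
      _ ≤ _ := by gcongr

end Approximation

/-! ### Finite mode and boundedness -/

/-- For large `s` the tent is at least `s / 2` on `[x, x + s / 4]`, so its value is at least `h x *
s² / 8`, which is quadratic unless `h x = 0`. -/
lemma eq_zero_of_monotoneOn {a C : ℝ} {h : ℝ → ℝ} (hmeas : Measurable h) (hnn : ∀ x, 0 ≤ h x)
    (hC : ∀ x, h x ≤ C) (hmono : MonotoneOn h (Ici a))
    (hlim : Tendsto (fun s : ℝ => tentValue a h s / s ^ 2) atTop (𝓝 0)) {x : ℝ} (hx : a ≤ x) :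
    h x = 0 := by
  by_contra hne
  have hpos : 0 < h x := lt_of_le_of_ne (hnn x) (Ne.symm hne)
  have hev := (hlim.eventually_lt_const (show 0 < h x / 8 by positivity)).and
    (eventually_gt_atTop (max 0 (4 * (x - a))))
  obtain ⟨s, hs1, hs2⟩ := hev.exists
  obtain ⟨hs0, hsx⟩ := max_lt_iff.1 hs2
  rw [div_lt_iff₀ (by positivity)] at hs1
  have hi := integrableOn_mul_of_bounded hmeas hnn hC (integrableOn_tent a s)
  have hsub : Icc x (x + s / 4) ⊆ Ici a := fun y hy => hx.trans hy.1
  have h1 : ∫ _y in Icc x (x + s / 4), h x * (s / 2) ≤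
      ∫ y in Icc x (x + s / 4), h y * tent a s y := by
    refine setIntegral_mono_on continuousOn_const.integrableOn_Icc (hi.mono_set hsub)
      measurableSet_Icc fun y hy => ?_
    refine mul_le_mul (hmono hx (hsub hy) hy.1) ?_ (by positivity) (hnn y)
    exact le_trans (by linarith [hy.2]) (le_max_left _ _)
  have h2 : ∫ y in Icc x (x + s / 4), h y * tent a s y ≤ tentValue a h s :=
    setIntegral_mono_set hi
      (Eventually.of_forall fun y => mul_nonneg (hnn y) (tent_nonneg _ _ _)) hsub.eventuallyLE
  rw [setIntegral_const, Real.volume_real_Icc_of_le (by linarith), smul_eq_mul] at h1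
  have h3 : (x + s / 4 - x) * (h x * (s / 2)) = h x / 8 * s ^ 2 := by ring
  linarith

/-- When the value of long tents grows subquadratically, the mode may be taken finite. -/
lemma IsUnimodal.exists_mode {a C : ℝ} {h : ℝ → ℝ} (hh : IsUnimodal a h) (hmeas : Measurable h)
    (hC : ∀ x, h x ≤ C)
    (hlim : Tendsto (fun s : ℝ => tentValue a h s / s ^ 2) atTop (𝓝 0)) :
    ∃ c : ℝ, a ≤ c ∧ MonotoneOn h (Ico a c) ∧ AntitoneOn h (Ioi c) := by
  obtain ⟨c, hac, hmono, hanti⟩ := hh.mode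
  induction c with
  | bot => simp at hac
  | coe c =>
    refine ⟨c, EReal.coe_le_coe_iff.1 hac, hmono.mono fun x hx => ⟨hx.1, ?_⟩,
      hanti.mono fun x hx => ?_⟩
    · exact EReal.coe_lt_coe_iff.2 hx.2
    · exact EReal.coe_lt_coe_iff.2 hx
  | top =>
    have h0 : ∀ x, a ≤ x → h x = 0 := fun x hx =>
      eq_zero_of_monotoneOn hmeas hh.nonneg hC
        (hmono.mono fun x hx => ⟨hx, EReal.coe_lt_top x⟩) hlim hx
    refine ⟨a, le_rfl, fun x hx => absurd hx.2 (not_lt.2 hx.1), fun x hx y hy _ => ?_⟩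
    rw [h0 x (le_of_lt hx), h0 y (le_of_lt hy)]

lemma IsFeasible.objective_le {a β η ν C : ℝ} {h f : ℝ → ℝ} (hf : IsFeasible a β η ν f)
    (hmeas : Measurable h) (hnn : ∀ x, 0 ≤ h x) (hC : ∀ x, h x ≤ C) :
    objective a h f ≤ C * β := by
  rw [← hf.integral_eq, ← integral_const_mul]
  exact setIntegral_mono_on (integrableOn_mul_of_bounded hmeas hnn hC hf.integrableOn)
    (hf.integrableOn.const_mul C) measurableSet_Ici
    fun x hx => mul_le_mul_of_nonneg_right (hC x) (hf.nonneg x hx)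

end ConvexTail

/-! ### Limit of a maximizing sequence -/

theorem corollary1 (a β η ν : ℝ) (hβ : 0 < β) (hη : 0 < η) (hν : 0 < ν)
    (h : ℝ → ℝ) (hmeas : Measurable h) (hh : ConvexTail.IsUnimodal a h)
    (lam : ℝ)
    (hlim : Filter.Tendsto (fun x : ℝ => ConvexTail.H a h x / x ^ 2) Filter.atTop (nhds lam))
    (hcons : ∃ f : ℝ → ℝ, ConvexTail.IsFeasible a β η ν f)
    (hlam : lam = 0) :
    ∃ f : ℝ → ℝ, ConvexTail.IsOptimal a β η ν h f ∧ f ∈ ConvexTail.PLPos 2 a := by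
  open ConvexTail in
  subst hlam
  have hnn := hh.nonneg
  obtain ⟨C, hC⟩ := hh.bounded
  have hΦlim := tendsto_tentValue_div_sq hmeas hnn hC hlim
  obtain ⟨c, hac, hmono, hanti⟩ := hh.exists_mode hmeas hC hΦlim
  set S : Set ℝ := objective a h '' {f | IsFeasible a β η ν f} with hS
  have hSne : S.Nonempty := hcons.imp' (objective a h) fun f hf => ⟨f, hf, rfl⟩
  have hSb : BddAbove S :=
    ⟨C * β, by rintro _ ⟨f, hf, rfl⟩; exact IsFeasible.objective_le hf hmeas hnn hC⟩
  -- Near-optimal tails become two-tent sums whose excess mass and value deficit both tend to zero.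
  have hseq : ∀ n : ℕ, ∃ b w₁ s₁ w₂ s₂ : ℝ, β ≤ b ∧ b ≤ β + 1 / ((n : ℝ) + 1) ∧
      IsTwoTent η ν b w₁ s₁ w₂ s₂ ∧
      sSup S - 1 / ((n : ℝ) + 1) ≤ w₁ * tentValue a h s₁ + w₂ * tentValue a h s₂ := by
    intro n
    have hn : 0 < 1 / ((n : ℝ) + 1) := Nat.one_div_pos_of_nat
    obtain ⟨_, ⟨f, hf, rfl⟩, hfS⟩ :=
      exists_lt_of_lt_csSup hSne (show sSup S - 1 / ((n : ℝ) + 1) < sSup S by linarith)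
    obtain ⟨b, w₁, s₁, w₂, s₂, h1, h2, h3, h4⟩ :=
      IsFeasible.exists_twoTent hf hβ hη hmeas hnn hC hac hmono hanti hn
    exact ⟨b, w₁, s₁, w₂, s₂, h1, h2, h3, hfS.le.trans h4⟩
  choose b w₁ s₁ w₂ s₂ hb1 hb2 hc hval using hseq
  have hone := tendsto_one_div_add_atTop_nhds_zero_nat (𝕜 := ℝ)
  have hb : Tendsto b atTop (𝓝 β) := by
    refine tendsto_of_tendsto_of_tendsto_of_le_of_le tendsto_const_nhds ?_ hb1 hb2
    simpa using hone.const_add β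
  have hv : Tendsto (fun n : ℕ => sSup S - 1 / ((n : ℝ) + 1)) atTop (𝓝 (sSup S)) := by
    simpa using hone.const_sub (sSup S)
  obtain ⟨x₁, t₁, x₂, t₂, hcfg, hV⟩ := exists_isTwoTent_of_tendsto hη hβ
    (convexOn_tentValue hmeas hnn hC) tentValue_zero (tentValue_nonneg hnn) hΦlim hb hv hc hval
  refine ⟨twoTent a x₁ t₁ x₂ t₂, ⟨hcfg.isFeasible a, fun g hg => ?_⟩, hcfg.mem_PLPos a⟩
  rw [objective_twoTent hmeas hnn hC]
  exact (le_csSup hSb ⟨g, hg, rfl⟩).trans hV
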